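/- Let $m\ge 1$ and let $\gamma_{ij}:\mathbb{R}\to\mathbb{R}$ ($i,j\in\{1,\dots,m\}$, $i\ne j$) be locally Lipschitz functions. A function $\alpha:\mathbb{R}_{\ge0}\to\mathbb{R}_{\ge0}$ is of class $\mathcal K$ if it is continuous, strictly increasing and $\alpha(0)=0$. A function $\beta:\mathbb{R}_{\ge0}\times\mathbb{R}_{\ge0}\to\mathbb{R}_{\ge0}$ is of class $\mathcal{KL}$ if $\beta(\cdot,t)$ is of class $\mathcal K$ for each $t\ge0$, and $\beta(s,\cdot)$ is nonincreasing with $\lim_{t\to\infty}\beta(s,t)=0$ for each $s\ge0$. Assume that $\{\gamma_{ij}\}$ is an interconnection, that is, for all $i\neq j$: (G1) $\gamma_{ij}(0)=0$ and $s\,\gamma_{ij}(s)\ge 0$ for all $s\in\mathbb{R}$; (G2) either $\gamma_{ij}\equiv0$, or there is a class-$\mathcal K$ function $\alpha$ with $|\gamma_{ij}(s)|\ge\alpha(|s|)$ for all $s\in\mathbb{R}$. Assume moreover that the interconnection is connected: the directed graph on $\{1,\dots,m\}$ with an edge from $i$ to $j$ iff $i\ne j$ and $\gamma_{ij}\not\equiv0$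 has a node to which there is a directed path from every other node. Define $\bar\gamma_{ij}:\mathbb{R}^2\to\mathbb{R}^2$ by $$\bar\gamma_{ij}(v)=\frac1{2\pi}\int_0^{2\pi}\begin{bmatrix}-\sin\varphi\\ \cos\varphi\end{bmatrix}\gamma_{ij}\big([-\sin\varphi\ \ \cos\varphi]\,v\big)\,d\varphi .$$ **Theorem.** For the averaged harmonic array $$\dot\eta_i=\sum_{j\ne i}\bar\gamma_{ij}(\eta_j-\eta_i),\qquad \eta_i\in\mathbb{R}^2,\quad i=1,\dots,m,$$ the synchronization manifold $\mathcal A=\{\eta\in\mathbb{R}^{2m}:\eta_i=\eta_j\text{ for all }i,j\}$ is globally asymptotically stable. That is, from every initial condition there is a solution defined for all $t\ge0$, and there is a class-$\mathcal{KL}$ function $\beta$ such that every solution $\eta$, whether given on $[0,\infty)$ or only on a bounded interval $[0,T]$, satisfies $$|\eta(t)|_{\mathcal A}\le\beta\big(|\eta(0)|_{\mathcal A},\,t\big)$$ for all $t$ in its interval of definition, where $|\cdot|_{\mathcal A}$ is the Euclidean distance to $\mathcal A$. -/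

import Mathlib

open scoped NNReal

noncomputable section

/-- The plane `ℝ²` with the Euclidean norm: the state space of one oscillator. -/
abbrev Plane : Type := EuclideanSpace ℝ (Fin 2)

/-- The space `ℝ²ᵐ` with the Euclidean norm, a point being written `η = (η₁, …, ηₘ)` with
`ηᵢ ∈ ℝ²`. -/
abbrev ArrayState (m : ℕ) : Type := PiLp 2 (fun _ : Fin m => Plane)

/-- Class-`𝒦` functions: continuous, zero at zero, strictly increasing. -/
structure IsClassK (α : ℝ≥0 → ℝ≥0) : Prop where
  continuous : Continuous α
  map_zero : α 0 = 0
  strictMono : StrictMono α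

/-- Class-`𝒦ℒ` functions: class-`𝒦` in the first argument, nonincreasing and tending to zero in
the second one. -/
structure IsClassKL (β : ℝ≥0 → ℝ≥0 → ℝ≥0) : Prop where
  isClassK : ∀ t, IsClassK (fun s => β s t)
  antitone : ∀ s, Antitone (β s)
  tendsto_zero : ∀ s, Filter.Tendsto (β s) Filter.atTop (nhds 0)

/-- `{γᵢⱼ}` with `i ≠ j` is an interconnection: (G1) and (G2) hold. The diagonal functions `γᵢᵢ`
play no role here or below. -/
structure IsInterconnection {m : ℕ} (γ : Fin m → Fin m → ℝ → ℝ) : Prop where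
  map_zero : ∀ i j, i ≠ j → γ i j 0 = 0
  sector : ∀ i j, i ≠ j → ∀ s, 0 ≤ s * γ i j s
  zero_or_lower_bound : ∀ i j, i ≠ j →
    (∀ s, γ i j s = 0) ∨ ∃ α, IsClassK α ∧ ∀ s, (α ‖s‖₊ : ℝ) ≤ |γ i j s|

/-- The directed graph of `{γᵢⱼ}`: there is an edge from `i` to `j` iff `γᵢⱼ` is not identically
zero. -/
def interconnectionGraph {m : ℕ} (γ : Fin m → Fin m → ℝ → ℝ) : Digraph (Fin m) where
  Adj i j := i ≠ j ∧ ∃ s, γ i j s ≠ 0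

/-- A directed graph is connected if it has a node to which there is a directed path from every
other node. -/
def IsConnectedDigraph {V : Type*} (G : Digraph V) : Prop :=
  ∃ k, ∀ i, i ≠ k → Relation.TransGen G.Adj i k

/-- The averaged coupling
`γ̄(v) = (1/2π) ∫₀^{2π} [-sin φ, cos φ]ᵀ γ([-sin φ, cos φ] v) dφ`. -/
def averagedCoupling (γ : ℝ → ℝ) (v : Plane) : Plane :=
  (1 / (2 * Real.pi)) • ∫ φ in (0 : ℝ)..(2 * Real.pi),
    γ (-Real.sin φ * v 0 + Real.cos φ * v 1) • (!₂[-Real.sin φ, Real.cos φ] : Plane)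

/-- The right-hand side of the averaged array of harmonic oscillators: its `i`-th block is
`∑_{j ≠ i} γ̄ᵢⱼ(ηⱼ - ηᵢ)`. -/
def averagedHarmonicField {m : ℕ} (γ : Fin m → Fin m → ℝ → ℝ) (η : ArrayState m) :
    ArrayState m :=
  WithLp.toLp 2 fun i => ∑ j ∈ Finset.univ.erase i, averagedCoupling (γ i j) (η j - η i)

/-- The synchronization manifold. -/
def synchronizationManifold (m : ℕ) : Set (ArrayState m) :=
  {η | ∀ i j, η i = η j}

section Stability

variable {E : Type*} [NormedAddCommGroup E] [NormedSpace ℝ E]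

/-- `x` solves `ẋ = g(x)` on the time interval `J` (with one-sided derivatives at endpoints
belonging to `J`). -/
def IsSolutionOn (g : E → E) (x : ℝ → E) (J : Set ℝ) : Prop :=
  ∀ t ∈ J, HasDerivWithinAt x (g (x t)) J t

/-- Global (uniform) asymptotic stability of the set `S` for `ẋ = g(x)`: from every initial
condition there is a solution on `[0, ∞)`, and a class-`𝒦ℒ` function `β` bounds the distance to
`S` along every solution, including solutions given on a bounded time interval only. -/
structure IsGloballyAsymptoticallyStable (g : E → E) (S : Set E) : Prop where
  exists_solution : ∀ x₀ : E, ∃ x : ℝ → E, x 0 = x₀ ∧ IsSolutionOn g x (Set.Ici 0)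
  exists_bound : ∃ β : ℝ≥0 → ℝ≥0 → ℝ≥0, IsClassKL β ∧
    ∀ (x : ℝ → E) (T : ℝ≥0), IsSolutionOn g x (Set.Icc 0 (T : ℝ)) →
      ∀ t : ℝ≥0, t ≤ T → Metric.infNndist (x t) S ≤ β (Metric.infNndist (x 0) S) t

end Stability

end

open scoped NNReal

noncomputable section

/-! The averaged coupling is radial, `γ̄(v) = c(v) v` with `c(v) ≥ 0`: its component along the
quarter turn of `v` is the integral of a total derivative over a period
(`inner_rotate_averagedCoupling`), and (G1) gives the sign. Hence, for each fixed direction `u`, the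
scalars `⟨u, ηᵢ⟩` form a consensus system with nonnegative weights. Half-planes containing all the
blocks are therefore invariant, and the diameter `spread` of the configuration never increases
(`spread_solution_le`).

If the diameter were positive and unchanged after a positive time, an extremal block in the
direction of that diameter would have been extremal all along. Its derivative then vanishes, so
every block it listens to is extremal too. Following paths to the root from both ends of the
diameter makes the root both maximal and minimal, which is absurd (`spread_solution_lt`).
Compactness modulo translations makes the decrease uniform (`exists_uniform_spread_decrease`),
whence a uniform attraction time; an envelope construction turns this into a class-`𝒦ℒ` bound
(`exists_isClassKL_of_uniformly_attractive`).

Only displacements bounded by the initial diameter matter, so `γᵢⱼ` may be frozen outside `[-R, R]`.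
The resulting field is bounded and globally Lipschitz, which supplies existence, uniqueness and
continuous dependence. -/

lemma isSolutionOn_continuousOn {E : Type*} [NormedAddCommGroup E] [NormedSpace ℝ E]
    {g : E → E} {x : ℝ → E} {J : Set ℝ} (h : IsSolutionOn g x J) : ContinuousOn x J :=
  fun t ht => (h t ht).continuousWithinAt

/-! ### Radiality of the averaged coupling -/

/-- The component of `v` in the direction `[-sin φ, cos φ]`. -/
def angularComponent (φ : ℝ) (v : Plane) : ℝ := -Real.sin φ * v 0 + Real.cos φ * v 1

lemma continuous_angularComponent (v : Plane) : Continuous fun φ => angularComponent φ v := by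
  unfold angularComponent; fun_prop

lemma angularComponent_sub (φ : ℝ) (v w : Plane) :
    angularComponent φ (v - w) = angularComponent φ v - angularComponent φ w := by
  simp [angularComponent]; ring

lemma norm_angularVector (φ : ℝ) : ‖(!₂[-Real.sin φ, Real.cos φ] : Plane)‖ = 1 := by
  simp [EuclideanSpace.norm_eq, Fin.sum_univ_two]

lemma inner_angularVector (φ : ℝ) (w : Plane) :
    inner ℝ w (!₂[-Real.sin φ, Real.cos φ] : Plane) = angularComponent φ w := by
  simp [PiLp.inner_apply, Fin.sum_univ_two, angularComponent]

lemma abs_angularComponent_le (φ : ℝ) (v : Plane) : |angularComponent φ v| ≤ ‖v‖ := by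
  rw [← inner_angularVector]
  simpa [norm_angularVector] using
    abs_real_inner_le_norm v (!₂[-Real.sin φ, Real.cos φ] : Plane)

lemma continuous_averagedCoupling_integrand {γ : ℝ → ℝ} (hγ : Continuous γ) (v : Plane) :
    Continuous fun φ : ℝ =>
      γ (angularComponent φ v) • (!₂[-Real.sin φ, Real.cos φ] : Plane) := by
  refine (hγ.comp (continuous_angularComponent v)).smul ?_
  refine (PiLp.continuous_toLp 2 _).comp (continuous_pi fun i => ?_)
  fin_cases i <;> simp <;> fun_prop

lemma averagedCoupling_eq (γ : ℝ → ℝ) (v : Plane) :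
    averagedCoupling γ v = (1 / (2 * Real.pi)) • ∫ φ in (0 : ℝ)..(2 * Real.pi),
      γ (angularComponent φ v) • (!₂[-Real.sin φ, Real.cos φ] : Plane) := rfl

lemma inner_averagedCoupling {γ : ℝ → ℝ} (hγ : Continuous γ) (v w : Plane) :
    inner ℝ w (averagedCoupling γ v) = (1 / (2 * Real.pi)) * ∫ φ in (0 : ℝ)..(2 * Real.pi),
      γ (angularComponent φ v) * angularComponent φ w := by
  rw [averagedCoupling_eq, inner_smul_right]
  congr 1
  have h := (innerSL ℝ w).intervalIntegral_comp_comm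
    ((continuous_averagedCoupling_integrand hγ v).intervalIntegrable (μ := MeasureTheory.volume)
      0 (2 * Real.pi))
  rw [innerSL_apply_apply] at h
  rw [← h]
  refine intervalIntegral.integral_congr fun φ _ => ?_
  simp only [innerSL_apply_apply, inner_smul_right, inner_angularVector]

/-- With `a(φ)` the angular component of `v`, that of the rotated vector is `-a'(φ)`. The integrand
is thus `-γ(a) a'`, and `a` takes the same value at `0` and `2π`. -/
lemma inner_rotate_averagedCoupling {γ : ℝ → ℝ} (hγ : Continuous γ) (v : Plane) :
    inner ℝ (!₂[-v 1, v 0] : Plane) (averagedCoupling γ v) = 0 := by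
  rw [inner_averagedCoupling hγ]
  have h : ∀ φ : ℝ, HasDerivAt (fun φ => angularComponent φ v)
      (-angularComponent φ (!₂[-v 1, v 0] : Plane)) φ := by
    intro φ
    have := ((Real.hasDerivAt_sin φ).neg.mul_const (v 0)).add
      ((Real.hasDerivAt_cos φ).mul_const (v 1))
    refine this.congr_deriv ?_
    simp [angularComponent]
  have key := intervalIntegral.integral_comp_mul_deriv (a := 0) (b := 2 * Real.pi)
    (fun φ _ => h φ) (continuous_angularComponent _).neg.continuousOn hγ
  have h0 : angularComponent (2 * Real.pi) v = angularComponent 0 v := by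
    simp [angularComponent]
  simp only [Function.comp_apply, h0, intervalIntegral.integral_same, mul_neg,
    intervalIntegral.integral_neg, neg_eq_zero] at key
  rw [key, mul_zero]

lemma inner_averagedCoupling_nonneg {γ : ℝ → ℝ} (hγ : Continuous γ)
    (hs : ∀ s, 0 ≤ s * γ s) (v : Plane) : 0 ≤ inner ℝ v (averagedCoupling γ v) := by
  rw [inner_averagedCoupling hγ]
  refine mul_nonneg (by positivity) (intervalIntegral.integral_nonneg (by positivity) fun φ _ => ?_)
  rw [mul_comm]; exact hs _

lemma inner_averagedCoupling_pos {γ : ℝ → ℝ} (hγ : Continuous γ)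
    (hs : ∀ s, 0 ≤ s * γ s) (hne : ∀ s, s ≠ 0 → γ s ≠ 0) {v : Plane} (hv : v ≠ 0) :
    0 < inner ℝ v (averagedCoupling γ v) := by
  have hpi := Real.pi_pos
  rw [inner_averagedCoupling hγ]
  refine mul_pos (by positivity) (intervalIntegral.integral_pos (by positivity)
    ((hγ.comp (continuous_angularComponent v)).mul
      (continuous_angularComponent v)).continuousOn (fun φ _ => ?_) ?_)
  · rw [mul_comm]; exact hs _
  · have hex : ∃ φ ∈ Set.Icc (0 : ℝ) (2 * Real.pi), angularComponent φ v ≠ 0 := by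
      by_contra! hcon
      apply hv
      -- The angles `0` and `π/2` read off the two coordinates of `v` up to sign.
      have h0 := hcon 0 ⟨le_rfl, by positivity⟩
      have h1 := hcon (Real.pi / 2) ⟨by positivity, by linarith⟩
      simp [angularComponent] at h0 h1
      ext i; fin_cases i <;> simp [h0, h1]
    obtain ⟨φ, hφ, hne'⟩ := hex
    refine ⟨φ, hφ, lt_of_le_of_ne (by simpa [mul_comm] using hs (angularComponent φ v)) ?_⟩
    exact (mul_ne_zero (hne _ hne') hne').symm

lemma eq_smul_of_inner_rotate_eq_zero {v w : Plane}
    (h : inner ℝ (!₂[-v 1, v 0] : Plane) w = 0) :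
    ‖v‖ ^ 2 • w = (inner ℝ v w : ℝ) • v := by
  simp [PiLp.inner_apply, Fin.sum_univ_two] at h
  ext i
  fin_cases i
  · simp [PiLp.inner_apply, Fin.sum_univ_two, EuclideanSpace.norm_sq_eq]
    linear_combination (-v 1) * h
  · simp [PiLp.inner_apply, Fin.sum_univ_two, EuclideanSpace.norm_sq_eq]
    linear_combination (v 0) * h

lemma averagedCoupling_eq_smul {γ : ℝ → ℝ} (hγ : Continuous γ) {v : Plane} (hv : v ≠ 0) :
    averagedCoupling γ v = ((inner ℝ v (averagedCoupling γ v) : ℝ) / ‖v‖ ^ 2) • v := by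
  have hv' : ‖v‖ ^ 2 ≠ 0 := by simpa using hv
  rw [div_eq_inv_mul, mul_smul,
    ← eq_smul_of_inner_rotate_eq_zero (inner_rotate_averagedCoupling hγ v),
    inv_smul_smul₀ hv']

lemma norm_averagedCoupling_sub_le {γ : ℝ → ℝ} (hγ : Continuous γ) {C : ℝ} {v w : Plane}
    (h : ∀ φ, |γ (angularComponent φ v) - γ (angularComponent φ w)| ≤ C) :
    ‖averagedCoupling γ v - averagedCoupling γ w‖ ≤ C := by
  have hpi := Real.pi_pos
  rw [averagedCoupling_eq, averagedCoupling_eq, ← smul_sub, ← intervalIntegral.integral_sub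
    ((continuous_averagedCoupling_integrand hγ v).intervalIntegrable _ _)
    ((continuous_averagedCoupling_integrand hγ w).intervalIntegrable _ _), norm_smul]
  have := intervalIntegral.norm_integral_le_of_norm_le_const (a := 0) (b := 2 * Real.pi) (C := C)
    (f := fun φ => γ (angularComponent φ v) • (!₂[-Real.sin φ, Real.cos φ] : Plane) -
      γ (angularComponent φ w) • (!₂[-Real.sin φ, Real.cos φ] : Plane)) (fun φ _ => by
        rw [← sub_smul, norm_smul, norm_angularVector, mul_one]; exact h φ)
  rw [sub_zero, abs_of_pos (by positivity)] at this
  rw [Real.norm_of_nonneg (by positivity)]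
  calc 1 / (2 * Real.pi) * _ ≤ 1 / (2 * Real.pi) * (C * (2 * Real.pi)) := by gcongr
    _ = C := by field_simp

lemma averagedCoupling_zero {γ : ℝ → ℝ} (h0 : γ 0 = 0) : averagedCoupling γ 0 = 0 := by
  rw [averagedCoupling_eq]
  simp [angularComponent, h0]

lemma averagedCoupling_congr {γ γ' : ℝ → ℝ} {R : ℝ} (h : ∀ s, |s| ≤ R → γ s = γ' s) {v : Plane}
    (hv : ‖v‖ ≤ R) : averagedCoupling γ v = averagedCoupling γ' v := by
  rw [averagedCoupling_eq, averagedCoupling_eq]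
  congr 1
  refine intervalIntegral.integral_congr fun φ _ => ?_
  simp only [h _ ((abs_angularComponent_le φ v).trans hv)]

/-- A globally Lipschitz coupling that is a nonnegative multiple of the displacement. -/
structure IsRadialCoupling (f : Plane → Plane) (K : ℝ≥0) : Prop where
  lipschitz : LipschitzWith K f
  radial : ∀ v, ∃ c : ℝ, 0 ≤ c ∧ f v = c • v

/-- Since `f 0 = 0`, the Lipschitz constant also bounds the multiplier; this gives the consensus
weights a common bound. -/
lemma IsRadialCoupling.exists_le {f : Plane → Plane} {K : ℝ≥0} (hf : IsRadialCoupling f K)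
    (v : Plane) : ∃ c : ℝ, 0 ≤ c ∧ c ≤ K ∧ f v = c • v := by
  obtain ⟨c, hc, hcv⟩ := hf.radial v
  have hf0 : f 0 = 0 := by obtain ⟨d, _, hd⟩ := hf.radial 0; simpa using hd
  by_cases hv : v = 0
  · exact ⟨0, le_rfl, K.2, by simp [hv, hf0]⟩
  · refine ⟨c, hc, ?_, hcv⟩
    have := hf.lipschitz.norm_sub_le v 0
    rw [hf0, sub_zero, sub_zero, hcv, norm_smul, Real.norm_of_nonneg hc] at this
    exact le_of_mul_le_mul_right this (norm_pos_iff.2 hv)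

lemma isRadialCoupling_averagedCoupling {γ : ℝ → ℝ} {K : ℝ≥0} (hγ : LipschitzWith K γ)
    (h0 : γ 0 = 0) (hs : ∀ s, 0 ≤ s * γ s) : IsRadialCoupling (averagedCoupling γ) K where
  lipschitz := LipschitzWith.of_dist_le_mul fun v w => by
    rw [dist_eq_norm, dist_eq_norm]
    refine norm_averagedCoupling_sub_le hγ.continuous fun φ => ?_
    have := hγ.norm_sub_le (angularComponent φ v) (angularComponent φ w)
    rw [← angularComponent_sub, Real.norm_eq_abs, Real.norm_eq_abs] at this
    exact this.trans (by gcongr; exact abs_angularComponent_le _ _)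
  radial v := by
    by_cases hv : v = 0
    · exact ⟨0, le_rfl, by simp [hv, averagedCoupling_zero h0]⟩
    · exact ⟨_, div_nonneg (inner_averagedCoupling_nonneg hγ.continuous hs v) (by positivity),
        averagedCoupling_eq_smul hγ.continuous hv⟩

lemma averagedCoupling_ne_zero {γ : ℝ → ℝ} (hγ : Continuous γ)
    (hs : ∀ s, 0 ≤ s * γ s) (hne : ∀ s, s ≠ 0 → γ s ≠ 0) {v : Plane} (hv : v ≠ 0) :
    averagedCoupling γ v ≠ 0 := by
  intro h
  have := inner_averagedCoupling_pos hγ hs hne hv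
  simp [h] at this

/-! ### Freezing the couplings outside a bounded interval -/

/-- The function `γ` stopped outside `[-R, R]`. -/
def clampCoupling (R : ℝ≥0) (γ : ℝ → ℝ) (s : ℝ) : ℝ := γ (max (-(R : ℝ)) (min R s))

lemma clampCoupling_of_abs_le {R : ℝ≥0} {γ : ℝ → ℝ} {s : ℝ} (h : |s| ≤ R) :
    clampCoupling R γ s = γ s := by
  rw [abs_le] at h
  rw [clampCoupling, min_eq_right h.2, max_eq_right h.1]

lemma clamp_mem (R : ℝ≥0) (s : ℝ) : max (-(R : ℝ)) (min R s) ∈ Set.Icc (-(R : ℝ)) R :=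
  ⟨le_max_left _ _, max_le (by simp) (min_le_left _ _)⟩

/-- Clamping `s` to `[-R, R]` never reverses its sign; for `R = 0` it gives `0`, where `γ` vanishes.
-/
lemma clampCoupling_sector {R : ℝ≥0} {γ : ℝ → ℝ} (h0 : γ 0 = 0) (hs : ∀ s, 0 ≤ s * γ s) (s : ℝ) :
    0 ≤ s * clampCoupling R γ s := by
  have hR : (0 : ℝ) ≤ R := R.2
  unfold clampCoupling
  have hc := hs (max (-(R : ℝ)) (min R s))
  rcases lt_trichotomy s 0 with h | h | h
  · rw [min_eq_right (h.le.trans hR)] at hc ⊢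
    rcases eq_or_lt_of_le (max_le (by simp) h.le : max (-(R : ℝ)) s ≤ 0) with h' | h'
    · rw [h', h0, mul_zero]
    · exact mul_nonneg_of_nonpos_of_nonpos h.le (nonpos_of_mul_nonneg_right hc h')
  · simp [h]
  · have h1 : 0 ≤ min (R : ℝ) s := le_min hR h.le
    rw [max_eq_right (by linarith)] at hc ⊢
    rcases eq_or_lt_of_le h1 with h' | h'
    · rw [← h', h0, mul_zero]
    · exact mul_nonneg h.le (nonneg_of_mul_nonneg_right hc h')

lemma clampCoupling_ne_zero {R : ℝ≥0} (hR : 0 < R) {γ : ℝ → ℝ} (hne : ∀ s, s ≠ 0 → γ s ≠ 0) {s : ℝ}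
    (h : s ≠ 0) : clampCoupling R γ s ≠ 0 := by
  have hR' : (0 : ℝ) < R := hR
  refine hne _ ?_
  rcases lt_or_gt_of_ne h with h | h
  · exact (max_lt (by simpa using hR') (min_lt_of_right_lt h)).ne
  · exact (lt_max_of_lt_right (lt_min hR' h)).ne'

lemma exists_lipschitzWith_clampCoupling (R : ℝ≥0) {γ : ℝ → ℝ} (hγ : LocallyLipschitz γ) :
    ∃ K, LipschitzWith K (clampCoupling R γ) := by
  obtain ⟨K, hK⟩ := LocallyLipschitzOn.exists_lipschitzOnWith_of_compact
    (isCompact_Icc (a := -(R : ℝ)) (b := R)) (hγ.locallyLipschitzOn (s := Set.Icc (-(R : ℝ)) R))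
  refine ⟨K * 1, lipschitzOnWith_univ.1 (hK.comp (f := fun s => max (-(R : ℝ)) (min R s))
    (lipschitzOnWith_univ.2 ?_) fun s _ => clamp_mem R s)⟩
  exact (LipschitzWith.id.const_min (R : ℝ)).const_max _

lemma exists_norm_averagedCoupling_clampCoupling_le (R : ℝ≥0) {γ : ℝ → ℝ}
    (hγ : LocallyLipschitz γ) (h0 : γ 0 = 0) :
    ∃ C : ℝ, ∀ v, ‖averagedCoupling (clampCoupling R γ) v‖ ≤ C := by
  obtain ⟨C, hC⟩ := (isCompact_Icc (a := -(R : ℝ)) (b := R)).exists_bound_of_continuousOn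
    hγ.continuous.continuousOn
  obtain ⟨K, hK⟩ := exists_lipschitzWith_clampCoupling R hγ
  have h0' : clampCoupling R γ 0 = 0 := by rw [clampCoupling_of_abs_le (by simp), h0]
  refine ⟨C, fun v => ?_⟩
  have := norm_averagedCoupling_sub_le hK.continuous (v := v) (w := 0) (C := C) fun φ => by
    rw [show angularComponent φ 0 = 0 by simp [angularComponent], h0', sub_zero]
    exact hC _ (clamp_mem R _)
  rwa [averagedCoupling_zero h0', sub_zero] at this

/-! ### From uniform attraction to a class-`𝒦ℒ` bound -/

/-- The values `r - 2 (s₀ - s)` over the triples `(s₀, t, r)` of a relation. -/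
def envelopeValues (P : ℝ≥0 → ℝ≥0 → ℝ≥0 → Prop) (s t : ℝ≥0) : Set ℝ≥0 :=
  {y | ∃ s₀ r, P s₀ t r ∧ y = r - 2 * (s₀ - s)}

lemma envelopeValues_le {P : ℝ≥0 → ℝ≥0 → ℝ≥0 → Prop} (hle : ∀ s t r, P s t r → r ≤ s)
    {s t y : ℝ≥0} (hy : y ∈ envelopeValues P s t) : y ≤ s := by
  obtain ⟨s₀, r, hP, rfl⟩ := hy
  have hr := hle _ _ _ hP
  rw [tsub_le_iff_right]
  rcases le_total s₀ s with h | h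
  · exact hr.trans (h.trans le_self_add)
  · obtain ⟨d, rfl⟩ := exists_add_of_le h
    rw [add_tsub_cancel_left]
    refine hr.trans (add_le_add_right ?_ _)
    rw [two_mul]; exact le_self_add

/-- The supremum `B s t` of the penalized values is monotone and 2-Lipschitz in `s`, so continuity
comes for free, and it dominates `r` because the penalty vanishes at `s₀ = s`. The penalty is
truncated at zero, so smaller `s₀` count in full. -/
lemma exists_isClassKL_of_uniformly_attractive (P : ℝ≥0 → ℝ≥0 → ℝ≥0 → Prop)
    (hle : ∀ s t r, P s t r → r ≤ s)
    (hanti : ∀ s t t' r', t ≤ t' → P s t' r' → ∃ r, r' ≤ r ∧ P s t r)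
    (hattr : ∀ R ε : ℝ≥0, 0 < ε → ∃ N : ℝ≥0, ∀ s t r, P s t r → s ≤ R → N ≤ t → r ≤ ε) :
    ∃ β, IsClassKL β ∧ ∀ s t r, P s t r → r ≤ β s t := by
  set B : ℝ≥0 → ℝ≥0 → ℝ≥0 := fun s t => sSup (envelopeValues P s t) with hB
  have hbdd : ∀ s t, BddAbove (envelopeValues P s t) := fun s t =>
    ⟨s, fun y hy => envelopeValues_le hle hy⟩
  have hmem : ∀ {s t s₀ r}, P s₀ t r → r - 2 * (s₀ - s) ≤ B s t := fun {s t s₀ r} hP =>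
    le_csSup (hbdd s t) ⟨s₀, r, hP, rfl⟩
  have hBle : ∀ s t, B s t ≤ s := fun s t => csSup_le' fun y hy => envelopeValues_le hle hy
  have hmono : ∀ t, Monotone fun s => B s t := by
    intro t s s' hss
    refine csSup_le' ?_
    rintro y ⟨s₀, r, hP, rfl⟩
    refine le_trans ?_ (hmem hP)
    gcongr
  have hlip : ∀ s d t, B (s + d) t ≤ B s t + 2 * d := by
    intro s d t
    refine csSup_le' ?_
    rintro y ⟨s₀, r, hP, rfl⟩
    refine le_trans ?_ (add_le_add_left (hmem (s := s) hP) _)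
    rw [tsub_le_iff_right]
    have h1 : r ≤ r - 2 * (s₀ - s) + 2 * (s₀ - s) := le_tsub_add
    have h2 : s₀ - s ≤ (s₀ - (s + d)) + d := by
      rw [tsub_le_iff_right, add_assoc, add_comm d s]; exact le_tsub_add
    calc r ≤ r - 2 * (s₀ - s) + 2 * (s₀ - s) := h1
      _ ≤ r - 2 * (s₀ - s) + 2 * ((s₀ - (s + d)) + d) := by gcongr
      _ = _ := by ring
  have hlip' : ∀ t, LipschitzWith 2 fun s => B s t := by
    intro t
    have key : ∀ s s', s ≤ s' → dist (B s t) (B s' t) ≤ 2 * dist s s' := by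
      intro s s' hss
      obtain ⟨d, rfl⟩ := exists_add_of_le hss
      have h1 : ((B s t : ℝ≥0) : ℝ) ≤ B (s + d) t := hmono t hss
      have h2 : ((B (s + d) t : ℝ≥0) : ℝ) ≤ B s t + 2 * d := by exact_mod_cast hlip s d t
      rw [dist_comm, dist_comm s, NNReal.dist_eq, NNReal.dist_eq, abs_of_nonneg (by linarith)]
      push_cast
      rw [add_sub_cancel_left, abs_of_nonneg d.coe_nonneg]
      linarith
    refine LipschitzWith.of_dist_le_mul fun s s' => ?_
    rcases le_total s s' with h | h
    · exact key s s' h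
    · rw [dist_comm, dist_comm s]; exact key s' s h
  have hantiB : ∀ s, Antitone (B s) := by
    intro s t t' htt
    refine csSup_le' ?_
    rintro y ⟨s₀, r', hP, rfl⟩
    obtain ⟨r, hr, hP'⟩ := hanti _ _ _ _ htt hP
    exact le_trans (tsub_le_tsub_right hr _) (hmem hP')
  have hBzero : ∀ s ε : ℝ≥0, 0 < ε → ∃ N, ∀ t, N ≤ t → B s t ≤ ε := by
    intro s ε hε
    -- Slope 2 rather than 1 makes triples with `s₀ ≥ 2s` contribute zero, as `r ≤ s₀ ≤ 2(s₀ - s)`;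
    -- only a bounded range of `s₀` remains.
    obtain ⟨N, hN⟩ := hattr (2 * s) ε hε
    refine ⟨N, fun t ht => csSup_le' ?_⟩
    rintro y ⟨s₀, r, hP, rfl⟩
    rcases le_total s₀ (2 * s) with h | h
    · exact tsub_le_self.trans (hN _ _ _ hP h ht)
    · have hr := hle _ _ _ hP
      have : r - 2 * (s₀ - s) = 0 := by
        rw [tsub_eq_zero_iff_le, mul_tsub]
        refine hr.trans (le_tsub_of_add_le_left ?_)
        rw [two_mul s₀]; gcongr
      rw [this]; exact zero_le
  -- The summand `s / (1 + t)` makes the monotone `B` strictly increasing in `s` and still decays in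
  -- `t`.
  refine ⟨fun s t => B s t + s / (1 + t), ⟨fun t => ⟨?_, ?_, ?_⟩, fun s t t' h => ?_, fun s => ?_⟩,
    fun s t r hP => ?_⟩
  · exact (hlip' t).continuous.add (continuous_id.div_const _)
  · have := hBle 0 t
    simp only [nonpos_iff_eq_zero] at this
    simp [this]
  · refine (hmono t).add_strictMono fun a b hab => ?_
    have : 0 < 1 + t := by positivity
    simp only [div_eq_mul_inv]
    exact mul_lt_mul_of_pos_right hab (inv_pos.2 this)
  · exact add_le_add (hantiB s h) (by gcongr)
  · have h1 : Filter.Tendsto (B s) Filter.atTop (nhds 0) := by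
      rw [tendsto_order]
      refine ⟨fun a ha => absurd ha (by simp), fun a ha => ?_⟩
      obtain ⟨N, hN⟩ := hBzero s (a / 2) (half_pos ha)
      filter_upwards [Filter.eventually_ge_atTop N] with t ht
      exact (hN t ht).trans_lt (NNReal.half_lt_self ha.ne')
    have h2 : Filter.Tendsto (fun t : ℝ≥0 => s / (1 + t)) Filter.atTop (nhds 0) := by
      rw [← NNReal.tendsto_coe]
      push_cast
      exact (Filter.tendsto_atTop_add_const_left _ _
        (NNReal.tendsto_coe_atTop.2 Filter.tendsto_id)).const_div_atTop (s : ℝ)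
    simpa using h1.add h2
  · refine le_trans ?_ le_self_add
    simpa using hmem (s := s) hP

lemma IsClassKL.const_mul_comp {β : ℝ≥0 → ℝ≥0 → ℝ≥0} (hβ : IsClassKL β) {a b : ℝ≥0} (ha : 0 < a)
    (hb : 0 < b) : IsClassKL fun s t => a * β (b * s) t where
  isClassK t :=
    { continuous := by
        have := (hβ.isClassK t).continuous
        fun_prop
      map_zero := by simp [(hβ.isClassK t).map_zero]
      strictMono := fun s s' h =>
        mul_lt_mul_of_pos_left ((hβ.isClassK t).strictMono (mul_lt_mul_of_pos_left h hb)) ha }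
  antitone s t t' h := mul_le_mul_right (hβ.antitone _ h) _
  tendsto_zero s := by simpa using (hβ.tendsto_zero (b * s)).const_mul a

/-! ### Scalar consensus systems -/

lemma hasDerivAt_sq_min_zero (x : ℝ) :
    HasDerivAt (fun y : ℝ => (min y 0) ^ 2) (2 * min x 0) x := by
  rcases lt_trichotomy x 0 with h | rfl | h
  · have h1 : HasDerivAt (fun y : ℝ => y ^ 2) (2 * min x 0) x := by
      simpa [min_eq_left h.le] using hasDerivAt_pow 2 x
    refine h1.congr_of_eventuallyEq ?_
    filter_upwards [eventually_lt_nhds h] with y hy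
    rw [min_eq_left hy.le]
  · have : HasFDerivAt (fun y : ℝ => (min y 0) ^ 2) (0 : ℝ →L[ℝ] ℝ) 0 := by
      refine Asymptotics.IsBigO.hasFDerivAt (n := 2) ?_ one_lt_two
      refine Asymptotics.IsBigO.of_bound 1 (Filter.Eventually.of_forall fun y => ?_)
      simp only [sub_zero, Real.norm_eq_abs, sq_abs, abs_pow, one_mul]
      rcases le_total y 0 with h | h
      · simp [min_eq_left h]
      · simp [min_eq_right h, sq_nonneg]
    simpa using this.hasDerivAt
  · have h1 : HasDerivAt (fun _ : ℝ => (0 : ℝ)) (2 * min x 0) x := by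
      simpa [min_eq_right h.le] using hasDerivAt_const x (0 : ℝ)
    refine h1.congr_of_eventuallyEq ?_
    filter_upwards [eventually_gt_nhds h] with y hy
    simp [min_eq_right hy.le]

/-- Scalar trajectories on `[0, T]`, each of which moves towards the others with nonnegative
bounded weights. -/
structure IsConsensusTrajectory {m : ℕ} (q : Fin m → ℝ → ℝ) (c : Fin m → Fin m → ℝ → ℝ)
    (K T : ℝ≥0) : Prop where
  weight_nonneg : ∀ i j t, 0 ≤ c i j t
  weight_le : ∀ i j t, c i j t ≤ K
  hasDeriv : ∀ i, ∀ t ∈ Set.Icc (0 : ℝ) T, HasDerivWithinAt (q i)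
    (∑ j ∈ Finset.univ.erase i, c i j t * (q j t - q i t)) (Set.Icc 0 T) t

namespace IsConsensusTrajectory

variable {m : ℕ} {q : Fin m → ℝ → ℝ} {c : Fin m → Fin m → ℝ → ℝ} {K T : ℝ≥0}

lemma const_sub (h : IsConsensusTrajectory q c K T) (a : ℝ) :
    IsConsensusTrajectory (fun i t => a - q i t) c K T where
  weight_nonneg := h.weight_nonneg
  weight_le := h.weight_le
  hasDeriv i t ht := by
    refine ((h.hasDeriv i t ht).const_sub a).congr_deriv ?_
    rw [← Finset.sum_neg_distrib]
    exact Finset.sum_congr rfl fun j _ => by ring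

lemma neg_part_estimate {a b w k : ℝ} (hw : 0 ≤ w) (hk : w ≤ k) :
    2 * min a 0 * (w * (b - a)) ≤ k * (min b 0) ^ 2 := by
  have h1 : 2 * min a 0 * (b - a) ≤ (min b 0) ^ 2 := by
    rcases le_total a 0 with ha | ha <;> rcases le_total b 0 with hb | hb
    · rw [min_eq_left ha, min_eq_left hb]; nlinarith [sq_nonneg (a - b)]
    · rw [min_eq_left ha, min_eq_right hb]; nlinarith [mul_nonneg (neg_nonneg.2 ha) hb]
    · rw [min_eq_right ha, min_eq_left hb]; nlinarith
    · rw [min_eq_right ha, min_eq_right hb]; simp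
  calc 2 * min a 0 * (w * (b - a)) = w * (2 * min a 0 * (b - a)) := by ring
    _ ≤ w * (min b 0) ^ 2 := by gcongr
    _ ≤ k * (min b 0) ^ 2 := by gcongr

lemma exp_hasDerivWithinAt {f : ℝ → ℝ} {f' b t : ℝ} {s : Set ℝ} (hf : HasDerivWithinAt f f' s t) :
    HasDerivWithinAt (fun t => Real.exp (b * t) * f t)
      (Real.exp (b * t) * (b * f t + f')) s t := by
  have h := (((hasDerivAt_id t).const_mul b).exp.hasDerivWithinAt (s := s)).mul hf
  refine h.congr_deriv ?_
  simp; ring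

/-- The sum `S` of squared negative parts satisfies `S' ≤ mK S` and starts at zero, so Grönwall's
argument keeps it zero. -/
lemma nonneg (h : IsConsensusTrajectory q c K T) (h0 : ∀ i, 0 ≤ q i 0) {t : ℝ}
    (ht : t ∈ Set.Icc (0 : ℝ) T) (i : Fin m) : 0 ≤ q i t := by
  set S : ℝ → ℝ := fun t => ∑ i, (min (q i t) 0) ^ 2 with hS
  have hSd : ∀ s ∈ Set.Icc (0 : ℝ) T, HasDerivWithinAt S (∑ i, 2 * min (q i s) 0 *
      ∑ j ∈ Finset.univ.erase i, c i j s * (q j s - q i s)) (Set.Icc 0 T) s := fun s hs =>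
    HasDerivWithinAt.fun_sum fun i _ =>
      (hasDerivAt_sq_min_zero (q i s)).comp_hasDerivWithinAt s (h.hasDeriv i s hs)
  have hle : ∀ s, (∑ i, 2 * min (q i s) 0 *
      ∑ j ∈ Finset.univ.erase i, c i j s * (q j s - q i s)) ≤ m * K * S s := by
    intro s
    have : ∀ i ∈ Finset.univ, 2 * min (q i s) 0 *
        ∑ j ∈ Finset.univ.erase i, c i j s * (q j s - q i s) ≤ K * S s := by
      intro i _
      rw [Finset.mul_sum, hS]
      simp only
      rw [Finset.mul_sum]
      refine (Finset.sum_le_sum fun j _ => neg_part_estimate (h.weight_nonneg i j s)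
        (h.weight_le i j s)).trans ?_
      exact Finset.sum_le_sum_of_subset_of_nonneg (Finset.erase_subset _ _)
        fun _ _ _ => mul_nonneg K.2 (sq_nonneg _)
    refine (Finset.sum_le_sum this).trans ?_
    simp [mul_assoc]
  have hanti : AntitoneOn (fun s => Real.exp (-(m * K) * s) * S s) (Set.Icc 0 T) := by
    have hd := fun s hs => exp_hasDerivWithinAt (b := -(m * K)) (hSd s hs)
    refine antitoneOn_of_hasDerivWithinAt_nonpos (convex_Icc _ _)
      (fun s hs => (hd s hs).continuousWithinAt)
      (fun s hs => (hd s (interior_subset hs)).mono interior_subset) fun s _ => ?_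
    exact mul_nonpos_of_nonneg_of_nonpos (Real.exp_pos _).le (by linarith [hle s])
  have h1 := hanti (⟨le_rfl, T.2⟩ : (0 : ℝ) ∈ Set.Icc (0 : ℝ) T) ht ht.1
  have hS0 : S 0 = 0 := by simp [hS, h0]
  simp only [hS0, mul_zero] at h1
  have h2 : S t ≤ 0 := nonpos_of_mul_nonpos_right h1 (Real.exp_pos _)
  have h3 : (min (q i t) 0) ^ 2 ≤ S t :=
    Finset.single_le_sum (f := fun i => (min (q i t) 0) ^ 2) (fun _ _ => sq_nonneg _)
      (Finset.mem_univ i)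
  have h4 : min (q i t) 0 = 0 := pow_eq_zero_iff two_ne_zero |>.1
    (le_antisymm (h3.trans h2) (sq_nonneg _))
  exact min_eq_right_iff.1 h4

/-- Once all components are nonnegative, the incoming terms `c qⱼ` only help, leaving `qᵢ' ≥ -mK
qᵢ`. Hence a component that is zero at some time was zero before. -/
lemma exp_mul_monotoneOn (h : IsConsensusTrajectory q c K T) (h0 : ∀ i, 0 ≤ q i 0) (i : Fin m) :
    MonotoneOn (fun t => Real.exp (m * K * t) * q i t) (Set.Icc 0 T) := by
  have hd := fun s hs => exp_hasDerivWithinAt (b := m * K) (h.hasDeriv i s hs)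
  refine monotoneOn_of_hasDerivWithinAt_nonneg (convex_Icc _ _)
    (fun s hs => (hd s hs).continuousWithinAt)
    (fun s hs => (hd s (interior_subset hs)).mono interior_subset) fun s hs => ?_
  have hs' := interior_subset hs
  refine mul_nonneg (Real.exp_pos _).le ?_
  have hq := fun j => h.nonneg h0 hs' j
  have h1 : ∑ j ∈ Finset.univ.erase i, -(K * q i s) ≤
      ∑ j ∈ Finset.univ.erase i, c i j s * (q j s - q i s) := by
    refine Finset.sum_le_sum fun j _ => ?_
    nlinarith [mul_nonneg (h.weight_nonneg i j s) (hq j),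
      mul_le_mul_of_nonneg_right (h.weight_le i j s) (hq i)]
  have h2 : ∑ j ∈ Finset.univ.erase i, -(K * q i s) ≥ ∑ j : Fin m, -(K * q i s) := by
    rw [Finset.sum_neg_distrib, Finset.sum_neg_distrib]
    exact neg_le_neg (Finset.sum_le_sum_of_subset_of_nonneg (Finset.erase_subset _ _)
      fun _ _ _ => mul_nonneg K.2 (hq i))
  have h3 : ∑ j : Fin m, -(K * q i s) = -(m * K * q i s) := by simp; ring
  linarith

lemma eq_zero_of_le (h : IsConsensusTrajectory q c K T) (h0 : ∀ i, 0 ≤ q i 0) {i : Fin m} {s t : ℝ}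
    (hs : 0 ≤ s) (hst : s ≤ t) (ht : t ≤ T) (hq : q i t = 0) : q i s = 0 := by
  have h1 := h.exp_mul_monotoneOn h0 i ⟨hs, hst.trans ht⟩ ⟨hs.trans hst, ht⟩ hst
  simp only [hq, mul_zero] at h1
  exact le_antisymm (nonpos_of_mul_nonpos_right h1 (Real.exp_pos _))
    (h.nonneg h0 ⟨hs, hst.trans ht⟩ i)

/-- Here `qᵢ` vanishes on all of `[0, T]`, so its one-sided derivative at `T` is zero. That
derivative is a sum of nonnegative terms, and each must vanish. -/
lemma weight_mul_eq_zero (h : IsConsensusTrajectory q c K T) (h0 : ∀ i, 0 ≤ q i 0) (hT : 0 < T)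
    {i j : Fin m} (hij : i ≠ j) (hq : q i T = 0) : c i j T * q j T = 0 := by
  have hmem : (T : ℝ) ∈ Set.Icc (0 : ℝ) T := ⟨T.2, le_rfl⟩
  have hz : HasDerivWithinAt (q i) 0 (Set.Icc 0 T) T :=
    (hasDerivWithinAt_const (T : ℝ) _ (0 : ℝ)).congr
      (fun s hs => h.eq_zero_of_le h0 hs.1 hs.2 le_rfl hq) hq
  have hd := (uniqueDiffOn_Icc (show (0 : ℝ) < T from hT) _ hmem).eq_deriv _
    (h.hasDeriv i T hmem) hz
  rw [Finset.sum_eq_zero_iff_of_nonneg] at hd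
  · simpa [hq] using hd j (Finset.mem_erase.2 ⟨hij.symm, Finset.mem_univ _⟩)
  · intro l _
    rw [hq, sub_zero]
    exact mul_nonneg (h.weight_nonneg i l T) (h.nonneg h0 hmem l)

end IsConsensusTrajectory

/-! ### Solutions of bounded, globally Lipschitz fields -/

section SolutionOperations

variable {E : Type*} [NormedAddCommGroup E] [NormedSpace ℝ E] {g : E → E} {x y : ℝ → E}

lemma IsSolutionOn.mono {J J' : Set ℝ} (h : IsSolutionOn g x J) (hJ : J' ⊆ J) :
    IsSolutionOn g x J' := fun t ht => (h t (hJ ht)).mono hJ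

lemma IsSolutionOn.hasDerivWithinAt_Ici {T t : ℝ} (h : IsSolutionOn g x (Set.Icc 0 T))
    (ht : t ∈ Set.Ico 0 T) : HasDerivWithinAt x (g (x t)) (Set.Ici t) t :=
  (h t ⟨ht.1, ht.2.le⟩).mono_of_mem_nhdsWithin (Icc_mem_nhdsGE_of_mem ht)

lemma IsSolutionOn.comp_add_right {T s T' : ℝ} (h : IsSolutionOn g x (Set.Icc 0 T)) (hs : 0 ≤ s)
    (hT : T' + s ≤ T) : IsSolutionOn g (fun t => x (t + s)) (Set.Icc 0 T') := by
  intro t ht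
  have h1 := h (t + s) ⟨by linarith [ht.1], by linarith [ht.2]⟩
  have h2 : HasDerivWithinAt (fun t : ℝ => t + s) 1 (Set.Icc 0 T') t :=
    (hasDerivAt_id t).add_const s |>.hasDerivWithinAt
  have hmaps : Set.MapsTo (fun t : ℝ => t + s) (Set.Icc 0 T') (Set.Icc 0 T) :=
    fun r hr => ⟨by linarith [hr.1], by linarith [hr.2]⟩
  simpa [Function.comp_def] using h1.scomp t h2 hmaps

lemma IsSolutionOn.dist_le {K : ℝ≥0} (hg : LipschitzWith K g) {T : ℝ}
    (hx : IsSolutionOn g x (Set.Icc 0 T)) (hy : IsSolutionOn g y (Set.Icc 0 T)) {t : ℝ}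
    (ht : t ∈ Set.Icc 0 T) : dist (x t) (y t) ≤ dist (x 0) (y 0) * Real.exp (K * t) := by
  have := dist_le_of_trajectories_ODE (v := fun _ => g) (fun _ => hg)
    (isSolutionOn_continuousOn hx) (fun s hs => hx.hasDerivWithinAt_Ici hs)
    (isSolutionOn_continuousOn hy) (fun s hs => hy.hasDerivWithinAt_Ici hs) le_rfl t ht
  rwa [sub_zero] at this

lemma IsSolutionOn.eq_of_eq_zero {K : ℝ≥0} (hg : LipschitzWith K g) {T : ℝ}
    (hx : IsSolutionOn g x (Set.Icc 0 T)) (hy : IsSolutionOn g y (Set.Icc 0 T))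
    (h0 : x 0 = y 0) {t : ℝ} (ht : t ∈ Set.Icc 0 T) : x t = y t := by
  have := hx.dist_le hg hy ht
  rw [h0, dist_self, zero_mul] at this
  exact dist_le_zero.1 this

variable [CompleteSpace E]

lemma exists_isSolutionOn_Icc {K : ℝ≥0} (hg : LipschitzWith K g) {C : ℝ≥0} (hC : ∀ x, ‖g x‖ ≤ C)
    (T : ℝ≥0) (x₀ : E) : ∃ x : ℝ → E, x 0 = x₀ ∧ IsSolutionOn g x (Set.Icc 0 (T : ℝ)) := by
  -- Boundedness of `g` lets the ball of radius `C * T` serve for any `T`, so no continuation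
  -- argument is needed.
  have hp : IsPicardLindelof (fun _ => g) (tmin := 0) (tmax := T) ⟨0, le_rfl, T.2⟩ x₀
      (C * T) 0 C K :=
    { lipschitzOnWith := fun _ _ => hg.lipschitzOnWith
      continuousOn := fun _ _ => continuousOn_const
      norm_le := fun _ _ x _ => hC x
      mul_max_le := by simp }
  exact hp.exists_eq_forall_mem_Icc_hasDerivWithinAt₀

lemma exists_isSolutionOn_Ici {K : ℝ≥0} (hg : LipschitzWith K g) {C : ℝ≥0} (hC : ∀ x, ‖g x‖ ≤ C)
    (x₀ : E) : ∃ x : ℝ → E, x 0 = x₀ ∧ IsSolutionOn g x (Set.Ici 0) := by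
  choose y hy0 hy using fun n : ℕ => exists_isSolutionOn_Icc hg hC (n : ℝ≥0) x₀
  have hy' : ∀ n : ℕ, IsSolutionOn g (y n) (Set.Icc 0 (n : ℝ)) := fun n => by simpa using hy n
  have heq : ∀ (n : ℕ) (t : ℝ), t ∈ Set.Icc (0 : ℝ) n → y (⌊t⌋₊ + 1) t = y n t := by
    intro n t ht
    have hlt : t ≤ ((⌊t⌋₊ + 1 : ℕ) : ℝ) := by push_cast; exact (Nat.lt_floor_add_one t).le
    refine ((hy' _).mono (Set.Icc_subset_Icc_right (min_le_left _ (n : ℝ)))).eq_of_eq_zero hg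
      ((hy' n).mono (Set.Icc_subset_Icc_right (min_le_right _ _))) ?_ ⟨ht.1, le_min hlt ht.2⟩
    rw [hy0, hy0]
  -- The `+ 1` puts `t` strictly below the right end of the chosen interval, so the derivative can
  -- be taken within `[0, ∞)`.
  refine ⟨fun t => y (⌊t⌋₊ + 1) t, hy0 _, fun t ht => ?_⟩
  have ht0 : (0 : ℝ) ≤ t := ht
  have hlt : t < ((⌊t⌋₊ + 1 : ℕ) : ℝ) := by push_cast; exact Nat.lt_floor_add_one t
  have hmem : t ∈ Set.Icc (0 : ℝ) ((⌊t⌋₊ + 1 : ℕ) : ℝ) := ⟨ht0, hlt.le⟩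
  refine ((hy' _ t hmem).congr (fun s hs => heq _ s hs) rfl).mono_of_mem_nhdsWithin ?_
  rw [← Set.Ici_inter_Iic]
  exact Filter.inter_mem self_mem_nhdsWithin (mem_nhdsWithin_of_mem_nhds (Iic_mem_nhds hlt))

end SolutionOperations

/-! ### Diameter of the configuration along network solutions -/

/-- The largest distance between two blocks of a state. -/
def spread {m : ℕ} (η : ArrayState m) : ℝ≥0 :=
  Finset.univ.sup fun p : Fin m × Fin m => nndist (η p.1) (η p.2)

lemma nndist_le_spread {m : ℕ} (η : ArrayState m) (i j : Fin m) :
    nndist (η i) (η j) ≤ spread η :=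
  Finset.le_sup_of_le (Finset.mem_univ (i, j)) le_rfl

lemma norm_sub_le_spread {m : ℕ} (η : ArrayState m) (i j : Fin m) :
    ‖η i - η j‖ ≤ spread η := by
  rw [← dist_eq_norm]; exact nndist_le_spread η i j

lemma continuous_spread (m : ℕ) : Continuous (spread (m := m)) :=
  Continuous.finset_sup_apply fun p _ => by fun_prop

lemma spread_le {m : ℕ} {η : ArrayState m} {r : ℝ≥0} (h : ∀ i j, ‖η i - η j‖ ≤ r) :
    spread η ≤ r :=
  Finset.sup_le fun p _ => by
    rw [← NNReal.coe_le_coe, coe_nndist, dist_eq_norm]; exact h p.1 p.2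

lemma exists_norm_sub_eq_spread {m : ℕ} [NeZero m] (η : ArrayState m) :
    ∃ i j, ‖η i - η j‖ = spread η := by
  obtain ⟨p, -, hp⟩ := Finset.exists_mem_eq_sup Finset.univ Finset.univ_nonempty
    fun p : Fin m × Fin m => nndist (η p.1) (η p.2)
  refine ⟨p.1, p.2, ?_⟩
  rw [spread, hp, coe_nndist, dist_eq_norm]

/-- The vector field of a network with couplings `f i j`. -/
def networkField {m : ℕ} (f : Fin m → Fin m → Plane → Plane) (η : ArrayState m) : ArrayState m :=
  WithLp.toLp 2 fun i => ∑ j ∈ Finset.univ.erase i, f i j (η j - η i)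

lemma networkField_congr {m : ℕ} {f f' : Fin m → Fin m → Plane → Plane} {η : ArrayState m}
    (h : ∀ i j, i ≠ j → f i j (η j - η i) = f' i j (η j - η i)) :
    networkField f η = networkField f' η := by
  unfold networkField
  congr 1
  funext i
  exact Finset.sum_congr rfl fun j hj => h i j (Finset.ne_of_mem_erase hj).symm

lemma norm_le_sum_norm {m : ℕ} (η : ArrayState m) : ‖η‖ ≤ ∑ i, ‖η i‖ := by
  rw [PiLp.norm_eq_of_L2]
  exact Real.sqrt_le_iff.2 ⟨by positivity, Finset.sum_sq_le_sq_sum_of_nonneg fun i _ => norm_nonneg _⟩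

section Network

variable {m : ℕ} {f : Fin m → Fin m → Plane → Plane} {K : ℝ≥0} {x : ℝ → ArrayState m} {T : ℝ≥0}

lemma exists_norm_networkField_le (h : ∀ i j, i ≠ j → ∃ C : ℝ, ∀ v, ‖f i j v‖ ≤ C) :
    ∃ C : ℝ≥0, ∀ η, ‖networkField f η‖ ≤ C := by
  have h' : ∀ i j, ∃ C : ℝ, i ≠ j → ∀ v, ‖f i j v‖ ≤ C := fun i j => by
    by_cases hij : i = j
    · exact ⟨0, fun h => absurd hij h⟩
    · obtain ⟨C, hC⟩ := h i j hij; exact ⟨C, fun _ => hC⟩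
  choose C hC using h'
  refine ⟨(∑ i, ∑ j ∈ Finset.univ.erase i, C i j).toNNReal, fun η => ?_⟩
  refine le_trans ?_ (Real.le_coe_toNNReal _)
  refine (norm_le_sum_norm _).trans (Finset.sum_le_sum fun i _ => ?_)
  exact (norm_sum_le _ _).trans (Finset.sum_le_sum fun j hj =>
    hC i j (Finset.ne_of_mem_erase hj).symm _)

lemma exists_lipschitzWith_networkField (hf : ∀ i j, i ≠ j → IsRadialCoupling (f i j) K) :
    ∃ L, LipschitzWith L (networkField f) := by
  refine ⟨∑ i : Fin m, ∑ j ∈ Finset.univ.erase i, K * 2,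
    LipschitzWith.of_dist_le_mul fun η ζ => ?_⟩
  rw [dist_eq_norm, dist_eq_norm]
  refine (norm_le_sum_norm _).trans ?_
  push_cast
  rw [Finset.sum_mul]
  refine Finset.sum_le_sum fun i _ => ?_
  rw [Finset.sum_mul, PiLp.sub_apply]
  simp only [networkField]
  rw [← Finset.sum_sub_distrib]
  refine (norm_sum_le _ _).trans (Finset.sum_le_sum fun j hj => ?_)
  refine ((hf i j (Finset.ne_of_mem_erase hj).symm).lipschitz.norm_sub_le _ _).trans ?_
  rw [mul_assoc]
  refine mul_le_mul_of_nonneg_left ?_ K.2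
  have h1 : η j - η i - (ζ j - ζ i) = (η - ζ) j - (η - ζ) i := by
    simp only [PiLp.sub_apply]; abel
  rw [h1, two_mul]
  exact (norm_sub_le _ _).trans (add_le_add (PiLp.norm_apply_le _ _) (PiLp.norm_apply_le _ _))

/-- Radiality is what decouples the projections: the same weights serve every direction `u`. -/
lemma exists_isConsensusTrajectory (hf : ∀ i j, i ≠ j → IsRadialCoupling (f i j) K)
    (hx : IsSolutionOn (networkField f) x (Set.Icc 0 (T : ℝ))) :
    ∃ c : Fin m → Fin m → ℝ → ℝ,
      (∀ i j t, i ≠ j → f i j (x t j - x t i) = c i j t • (x t j - x t i)) ∧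
      ∀ u : Plane, IsConsensusTrajectory (fun i t => inner ℝ u (x t i)) c K T := by
  have h : ∀ i j t, ∃ c : ℝ, 0 ≤ c ∧ c ≤ K ∧
      (i ≠ j → f i j (x t j - x t i) = c • (x t j - x t i)) := fun i j t => by
    by_cases hij : i = j
    · exact ⟨0, le_rfl, K.2, fun h => absurd hij h⟩
    · obtain ⟨c, h0, hK, hc⟩ := (hf i j hij).exists_le (x t j - x t i)
      exact ⟨c, h0, hK, fun _ => hc⟩
  choose c h0 hK hc using h
  refine ⟨c, hc, fun u => ⟨h0, hK, fun i t ht => ?_⟩⟩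
  have hd := ((innerSL ℝ u).comp (PiLp.proj 2 (fun _ : Fin m => Plane) i
    : ArrayState m →L[ℝ] Plane)).hasFDerivAt.comp_hasDerivWithinAt t (hx t ht)
  refine hd.congr_deriv ?_
  change inner ℝ u (∑ j ∈ Finset.univ.erase i, f i j (x t j - x t i)) = _
  rw [inner_sum]
  refine Finset.sum_congr rfl fun j hj => ?_
  rw [hc i j t (Finset.ne_of_mem_erase hj).symm, inner_smul_right, inner_sub_right]

lemma inner_sub_le (hf : ∀ i j, i ≠ j → IsRadialCoupling (f i j) K)
    (hx : IsSolutionOn (networkField f) x (Set.Icc 0 (T : ℝ))) {u : Plane} {M : ℝ}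
    (hM : ∀ i, inner ℝ u (x 0 i) ≤ M) (i : Fin m) : inner ℝ u (x T i) ≤ M := by
  obtain ⟨c, -, hc⟩ := exists_isConsensusTrajectory hf hx
  have := ((hc u).const_sub M).nonneg (fun i => sub_nonneg.2 (hM i)) ⟨T.2, le_rfl⟩ i
  exact sub_nonneg.1 this

lemma inner_eq_of_adj (hf : ∀ i j, i ≠ j → IsRadialCoupling (f i j) K)
    (hx : IsSolutionOn (networkField f) x (Set.Icc 0 (T : ℝ))) (hT : 0 < T) {u : Plane} {M : ℝ}
    (hM : ∀ i, inner ℝ u (x 0 i) ≤ M) {i j : Fin m} (hij : i ≠ j)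
    (hne : ∀ v, v ≠ 0 → f i j v ≠ 0) (hi : inner ℝ u (x T i) = M) : inner ℝ u (x T j) = M := by
  obtain ⟨c, hcf, hc⟩ := exists_isConsensusTrajectory hf hx
  have h := ((hc u).const_sub M).weight_mul_eq_zero (fun i => sub_nonneg.2 (hM i)) hT hij
    (sub_eq_zero.2 hi.symm)
  by_cases hv : x T j - x T i = 0
  · rw [sub_eq_zero.1 hv, hi]
  · have hc0 : c i j T ≠ 0 := fun h0 => hne _ hv (by rw [hcf i j T hij, h0, zero_smul])
    exact (sub_eq_zero.1 ((mul_eq_zero.1 h).resolve_left hc0)).symm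

lemma inner_eq_of_transGen (hf : ∀ i j, i ≠ j → IsRadialCoupling (f i j) K)
    (hx : IsSolutionOn (networkField f) x (Set.Icc 0 (T : ℝ))) (hT : 0 < T) {G : Digraph (Fin m)}
    (hG : ∀ i j, G.Adj i j → i ≠ j ∧ ∀ v, v ≠ 0 → f i j v ≠ 0) {u : Plane} {M : ℝ}
    (hM : ∀ i, inner ℝ u (x 0 i) ≤ M) {i k : Fin m} (hik : Relation.TransGen G.Adj i k)
    (hi : inner ℝ u (x T i) = M) : inner ℝ u (x T k) = M := by
  induction hik with
  | single h => exact inner_eq_of_adj hf hx hT hM (hG _ _ h).1 (hG _ _ h).2 hi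
  | tail _ h ih => exact inner_eq_of_adj hf hx hT hM (hG _ _ h).1 (hG _ _ h).2 ih

lemma exists_inner_bounds [NeZero m] (η : ArrayState m) (u : Plane) :
    ∃ M M' : ℝ, (∀ i, inner ℝ u (η i) ≤ M) ∧ (∀ i, M' ≤ inner ℝ u (η i)) ∧
      M - M' ≤ ‖u‖ * spread η := by
  obtain ⟨a, ha⟩ := Finite.exists_max fun i => (inner ℝ u (η i) : ℝ)
  obtain ⟨b, hb⟩ := Finite.exists_min fun i => (inner ℝ u (η i) : ℝ)
  refine ⟨_, _, ha, hb, ?_⟩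
  rw [← inner_sub_right]
  exact (real_inner_le_norm _ _).trans (by gcongr; exact norm_sub_le_spread η a b)

lemma le_inner_sub (hf : ∀ i j, i ≠ j → IsRadialCoupling (f i j) K)
    (hx : IsSolutionOn (networkField f) x (Set.Icc 0 (T : ℝ))) {u : Plane} {M : ℝ}
    (hM : ∀ i, M ≤ inner ℝ u (x 0 i)) (i : Fin m) : M ≤ inner ℝ u (x T i) := by
  have := inner_sub_le hf hx (u := -u) (M := -M)
    (fun i => by rw [inner_neg_left]; exact neg_le_neg (hM i)) i
  rwa [inner_neg_left, neg_le_neg_iff] at this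

/-- Test with `u = xᵢ(T) - xⱼ(T)`: invariance of the initial bounds gives `‖u‖² ≤ M - M' ≤ ‖u‖ ·
spread (x 0)`. -/
lemma spread_solution_le (hf : ∀ i j, i ≠ j → IsRadialCoupling (f i j) K)
    (hx : IsSolutionOn (networkField f) x (Set.Icc 0 (T : ℝ))) : spread (x T) ≤ spread (x 0) := by
  rcases Nat.eq_zero_or_pos m with rfl | hm
  · simp [spread]
  have : NeZero m := ⟨hm.ne'⟩
  refine spread_le fun i j => ?_
  obtain ⟨M, M', hM, hM', hMM⟩ := exists_inner_bounds (x 0) (x T i - x T j)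
  have h1 := inner_sub_le hf hx hM i
  have h2 := le_inner_sub hf hx hM' j
  have h3 := real_inner_self_eq_norm_sq (x T i - x T j)
  rw [inner_sub_right] at h3
  by_contra! hlt
  have := (spread (x 0)).coe_nonneg
  nlinarith [norm_nonneg (x T i - x T j)]

lemma spread_solution_lt (hf : ∀ i j, i ≠ j → IsRadialCoupling (f i j) K)
    (hx : IsSolutionOn (networkField f) x (Set.Icc 0 (T : ℝ))) (hT : 0 < T) {G : Digraph (Fin m)}
    (hG : ∀ i j, G.Adj i j → i ≠ j ∧ ∀ v, v ≠ 0 → f i j v ≠ 0) (hconn : IsConnectedDigraph G)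
    (h0 : spread (x 0) ≠ 0) : spread (x T) < spread (x 0) := by
  obtain ⟨k, hk⟩ := hconn
  have : NeZero m := ⟨fun h => by subst h; exact k.elim0⟩
  refine lt_of_le_of_ne (spread_solution_le hf hx) fun heq => ?_
  obtain ⟨i, j, hij⟩ := exists_norm_sub_eq_spread (x T)
  obtain ⟨M, M', hM, hM', hMM⟩ := exists_inner_bounds (x 0) (x T i - x T j)
  have h1 := inner_sub_le hf hx hM i
  have h2 := le_inner_sub hf hx hM' j
  have h3 := real_inner_self_eq_norm_sq (x T i - x T j)
  rw [inner_sub_right] at h3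
  rw [← heq, ← hij] at hMM
  have hpos : 0 < ‖x T i - x T j‖ := by
    rw [hij, heq]; exact NNReal.coe_pos.2 (pos_iff_ne_zero.2 h0)
  -- Equality of the diameters squeezes `‖u‖² ≤ M - M' ≤ ‖u‖²`, so both extreme values are attained
  -- at time `T`.
  have hi : inner ℝ (x T i - x T j) (x T i) = M := by nlinarith
  have hj : inner ℝ (x T i - x T j) (x T j) = M' := by nlinarith
  have hki : inner ℝ (x T i - x T j) (x T k) = M := by
    by_cases h : i = k
    · rw [← h, hi]
    · exact inner_eq_of_transGen hf hx hT hG hM (hk i h) hi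
  have hkj : inner ℝ (x T i - x T j) (x T k) = M' := by
    by_cases h : j = k
    · rw [← h, hj]
    · have := inner_eq_of_transGen hf hx hT hG (u := -(x T i - x T j)) (M := -M')
        (fun i => by rw [inner_neg_left]; exact neg_le_neg (hM' i)) (hk j h)
        (by rw [inner_neg_left, hj])
      rwa [inner_neg_left, neg_inj] at this
  nlinarith

end Network

/-! ### Uniform decrease by compactness -/

section Attraction

variable {m : ℕ} {f : Fin m → Fin m → Plane → Plane} {K : ℝ≥0}

lemma spread_solution_antitone (hf : ∀ i j, i ≠ j → IsRadialCoupling (f i j) K)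
    {x : ℝ → ArrayState m} {T s t : ℝ≥0}
    (hx : IsSolutionOn (networkField f) x (Set.Icc 0 (T : ℝ))) (hst : s ≤ t) (htT : t ≤ T) :
    spread (x t) ≤ spread (x s) := by
  obtain ⟨d, rfl⟩ := exists_add_of_le hst
  have hd : (d : ℝ) + s ≤ T := by rw [add_comm]; exact_mod_cast htT
  have := spread_solution_le hf (hx.comp_add_right (T' := d) s.2 hd)
  simpa [add_comm] using this

lemma spread_sub_const (η : ArrayState m) (a : Plane) :
    spread (η - WithLp.toLp 2 fun _ => a) = spread η := by
  simp [spread]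

lemma networkField_sub_const (η : ArrayState m) (a : Plane) :
    networkField f (η - WithLp.toLp 2 fun _ => a) = networkField f η := by
  simp [networkField]

lemma isCompact_setOf_spread_mem (k : Fin m) (δ R : ℝ≥0) :
    IsCompact {η : ArrayState m | η k = 0 ∧ spread η ∈ Set.Icc δ R} := by
  refine Metric.isCompact_of_isClosed_isBounded ?_ ?_
  · exact (isClosed_eq (by fun_prop) continuous_const).inter
      (isClosed_Icc.preimage (continuous_spread m))
  · refine (Metric.isBounded_closedBall (x := (0 : ArrayState m))
      (r := ∑ _i : Fin m, (R : ℝ))).subset fun η hη => ?_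
    rw [mem_closedBall_zero_iff]
    refine (norm_le_sum_norm η).trans (Finset.sum_le_sum fun i _ => ?_)
    have h1 := norm_sub_le_spread η i k
    rw [hη.1, sub_zero] at h1
    exact h1.trans (by exact_mod_cast hη.2.2)

/-- The loss of diameter over unit time is continuous in the initial state and translation
invariant. Pinning one block at the origin leaves a compact set, on which the loss attains a
positive minimum. -/
lemma exists_uniform_spread_decrease (hf : ∀ i j, i ≠ j → IsRadialCoupling (f i j) K)
    {C : ℝ≥0} (hC : ∀ η, ‖networkField f η‖ ≤ C) {G : Digraph (Fin m)}
    (hG : ∀ i j, G.Adj i j → i ≠ j ∧ ∀ v, v ≠ 0 → f i j v ≠ 0) (hconn : IsConnectedDigraph G)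
    {δ : ℝ≥0} (hδ : 0 < δ) (R : ℝ≥0) :
    ∃ κ : ℝ, 0 < κ ∧ ∀ x : ℝ → ArrayState m, IsSolutionOn (networkField f) x (Set.Icc 0 1) →
      spread (x 0) ∈ Set.Icc δ R → (spread (x 1) : ℝ) + κ ≤ spread (x 0) := by
  obtain ⟨L, hL⟩ := exists_lipschitzWith_networkField hf
  choose y hy0 hy using exists_isSolutionOn_Icc hL hC 1
  simp only [NNReal.coe_one] at hy
  have hcont : Continuous fun η => y η 1 := by
    refine (LipschitzWith.of_dist_le' (K := Real.exp L) fun η ζ => ?_).continuous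
    have := (hy η).dist_le hL (hy ζ) (t := 1) ⟨zero_le_one, le_rfl⟩
    rwa [hy0, hy0, mul_one, mul_comm] at this
  obtain ⟨k, -⟩ := id hconn
  have htrans : ∀ x : ℝ → ArrayState m, IsSolutionOn (networkField f) x (Set.Icc 0 1) →
      spread (x 0) ∈ Set.Icc δ R → ∃ η : ArrayState m, (η k = 0 ∧ spread η ∈ Set.Icc δ R) ∧
        spread η = spread (x 0) ∧ spread (y η 1) = spread (x 1) := by
    intro x hx hx0
    have hs : IsSolutionOn (networkField f) (fun t => x t - WithLp.toLp 2 fun _ => x 0 k)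
        (Set.Icc 0 1) := fun t ht => by
      rw [networkField_sub_const]; exact (hx t ht).sub_const _
    refine ⟨x 0 - WithLp.toLp 2 fun _ => x 0 k, ⟨by simp, by rwa [spread_sub_const]⟩,
      spread_sub_const _ _, ?_⟩
    rw [(hy _).eq_of_eq_zero hL hs (hy0 _) (⟨zero_le_one, le_rfl⟩ : (1 : ℝ) ∈ Set.Icc (0 : ℝ) 1),
      spread_sub_const]
  -- The compact set is empty, for instance, when `m = 1` or `R < δ`; then any `κ` works vacuously.
  rcases Set.eq_empty_or_nonempty {η : ArrayState m | η k = 0 ∧ spread η ∈ Set.Icc δ R} with he | he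
  · refine ⟨1, one_pos, fun x hx hx0 => ?_⟩
    obtain ⟨η, hη, -⟩ := htrans x hx hx0
    exact absurd (show η ∈ {η : ArrayState m | η k = 0 ∧ spread η ∈ Set.Icc δ R} from hη)
      (by rw [he]; exact Set.notMem_empty _)
  · obtain ⟨η₀, hη₀, hmin⟩ := (isCompact_setOf_spread_mem k δ R).exists_isMinOn he
      (f := fun η => (spread η : ℝ) - spread (y η 1))
      ((NNReal.continuous_coe.comp (continuous_spread m)).sub
        (NNReal.continuous_coe.comp ((continuous_spread m).comp hcont))).continuousOn
    refine ⟨(spread η₀ : ℝ) - spread (y η₀ 1), ?_, fun x hx hx0 => ?_⟩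
    · have := spread_solution_lt hf (T := 1) (by simpa using hy η₀) one_pos hG hconn
        (by rw [hy0]; exact (hδ.trans_le hη₀.2.1).ne')
      rw [hy0] at this
      exact sub_pos.2 (by exact_mod_cast this)
    · obtain ⟨η, hη, h1, h2⟩ := htrans x hx hx0
      have := isMinOn_iff.1 hmin η hη
      simp only [h1, h2] at this
      linarith

/-- As long as the diameter exceeds `ε`, each unit of time costs at least `κ`; more than `R / κ`
such steps would make it negative. -/
lemma exists_uniform_attraction_time (hf : ∀ i j, i ≠ j → IsRadialCoupling (f i j) K)
    {C : ℝ≥0} (hC : ∀ η, ‖networkField f η‖ ≤ C) {G : Digraph (Fin m)}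
    (hG : ∀ i j, G.Adj i j → i ≠ j ∧ ∀ v, v ≠ 0 → f i j v ≠ 0) (hconn : IsConnectedDigraph G)
    (R : ℝ≥0) {ε : ℝ≥0} (hε : 0 < ε) :
    ∃ N : ℝ≥0, ∀ (x : ℝ → ArrayState m) (T t : ℝ≥0),
      IsSolutionOn (networkField f) x (Set.Icc 0 (T : ℝ)) → spread (x 0) ≤ R → t ≤ T → N ≤ t →
        spread (x t) ≤ ε := by
  obtain ⟨κ, hκ, hdec⟩ := exists_uniform_spread_decrease hf hC hG hconn hε R
  obtain ⟨N, hN⟩ := exists_nat_gt ((R : ℝ) / κ)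
  refine ⟨N, fun x T t hx h0 htT hNt => ?_⟩
  by_contra! hlt
  have key : ∀ n : ℕ, (n : ℝ≥0) ≤ t → (spread (x n) : ℝ) + n * κ ≤ R := by
    intro n
    induction n with
    | zero => intro _; simpa using h0
    | succ n ih =>
      intro hn
      push_cast at hn
      have hnt : (n : ℝ≥0) ≤ t := le_self_add.trans hn
      have hT : (1 : ℝ) + n ≤ T := by
        rw [add_comm]; exact_mod_cast hn.trans htT
      have h1 := hdec _ (hx.comp_add_right n.cast_nonneg hT) ?_
      · have h2 := ih hnt
        rw [add_comm (1 : ℝ)] at h1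
        simp only [zero_add] at h1
        push_cast
        linarith
      · have h3 : spread (x n) ≤ spread (x 0) := by
          simpa using spread_solution_antitone hf hx (s := 0) (t := n) zero_le
            (hnt.trans htT)
        have h4 : spread (x t) ≤ spread (x n) := by
          simpa using spread_solution_antitone hf hx hnt htT
        simp only [zero_add]
        exact ⟨hlt.le.trans h4, h3.trans h0⟩
  have h5 := key N hNt
  rw [div_lt_iff₀ hκ] at hN
  have := (spread (x N)).coe_nonneg
  linarith

end Attraction

/-! ### Diameter versus distance to the synchronization manifold -/

section SynchronizationDistance

variable {m : ℕ}

lemma infNndist_synchronizationManifold_le (η : ArrayState m) :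
    Metric.infNndist η (synchronizationManifold m) ≤ m * spread η := by
  rw [← NNReal.coe_le_coe, Metric.coe_infNndist]
  push_cast
  rcases Nat.eq_zero_or_pos m with rfl | hm
  · rw [Metric.infDist_zero_of_mem (fun i => i.elim0)]; simp
  · have hmem : (WithLp.toLp 2 fun _ => η ⟨0, hm⟩ : ArrayState m) ∈ synchronizationManifold m :=
      fun i j => rfl
    refine (Metric.infDist_le_dist_of_mem hmem).trans ?_
    rw [dist_eq_norm]
    refine (norm_le_sum_norm _).trans
      ((Finset.sum_le_sum fun i _ => norm_sub_le_spread η i ⟨0, hm⟩).trans ?_)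
    simp

lemma spread_le_two_mul_infNndist (η : ArrayState m) :
    spread η ≤ 2 * Metric.infNndist η (synchronizationManifold m) := by
  refine spread_le fun i j => ?_
  push_cast
  rw [Metric.coe_infNndist, ← div_le_iff₀' two_pos,
    Metric.le_infDist ⟨0, show (0 : ArrayState m) ∈ synchronizationManifold m from
      fun i j => rfl⟩]
  intro a ha
  have h1 : η i - η j = (η - a) i - (η - a) j := by
    simp only [PiLp.sub_apply, ha i j]; abel
  rw [div_le_iff₀' two_pos, h1, two_mul, dist_eq_norm]
  exact (norm_sub_le _ _).trans (add_le_add (PiLp.norm_apply_le _ _) (PiLp.norm_apply_le _ _))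

end SynchronizationDistance

/-! ### Transfer to the original interconnection -/

section Interconnection

variable {m : ℕ} {γ : Fin m → Fin m → ℝ → ℝ}

/-- The averaged couplings of the functions stopped outside `[-R, R]`. -/
def clampedCoupling (γ : Fin m → Fin m → ℝ → ℝ) (R : ℝ≥0) (i j : Fin m) : Plane → Plane :=
  averagedCoupling (clampCoupling R (γ i j))

lemma averagedHarmonicField_eq_of_spread_le {R : ℝ≥0} {η : ArrayState m} (h : spread η ≤ R) :
    averagedHarmonicField γ η = networkField (clampedCoupling γ R) η := by
  refine networkField_congr fun i j _ => ?_
  exact averagedCoupling_congr (fun s hs => (clampCoupling_of_abs_le hs).symm)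
    ((norm_sub_le_spread η j i).trans (by exact_mod_cast h))

lemma IsInterconnection.ne_zero (hγ : IsInterconnection γ) {i j : Fin m} (hij : i ≠ j)
    (h : ∃ s, γ i j s ≠ 0) {s : ℝ} (hs : s ≠ 0) : γ i j s ≠ 0 := by
  obtain ⟨s', hs'⟩ := h
  rcases hγ.zero_or_lower_bound i j hij with h0 | ⟨α, hα, hle⟩
  · exact absurd (h0 s') hs'
  · have h1 : α 0 < α ‖s‖₊ := hα.strictMono (by simpa using hs)
    rw [hα.map_zero] at h1
    exact abs_pos.1 ((NNReal.coe_pos.2 h1).trans_le (hle s))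

lemma IsInterconnection.exists_isRadialCoupling (hγ : IsInterconnection γ)
    (hlip : ∀ i j, i ≠ j → LocallyLipschitz (γ i j)) (R : ℝ≥0) :
    ∃ K, ∀ i j, i ≠ j → IsRadialCoupling (clampedCoupling γ R i j) K := by
  have h : ∀ i j, ∃ K : ℝ≥0, i ≠ j → LipschitzWith K (clampCoupling R (γ i j)) := fun i j => by
    by_cases hij : i = j
    · exact ⟨0, fun h => absurd hij h⟩
    · obtain ⟨K, hK⟩ := exists_lipschitzWith_clampCoupling R (hlip i j hij)
      exact ⟨K, fun _ => hK⟩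
  choose K hK using h
  refine ⟨∑ i, ∑ j, K i j, fun i j hij => ?_⟩
  have hle : K i j ≤ ∑ i, ∑ j, K i j :=
    (Finset.single_le_sum_of_canonicallyOrdered (f := K i) (Finset.mem_univ j)).trans
      (Finset.single_le_sum_of_canonicallyOrdered (f := fun i => ∑ j, K i j) (Finset.mem_univ i))
  refine isRadialCoupling_averagedCoupling ((hK i j hij).weaken hle) ?_
    (clampCoupling_sector (hγ.map_zero i j hij) (hγ.sector i j hij))
  rw [clampCoupling_of_abs_le (by simp), hγ.map_zero i j hij]

lemma IsInterconnection.exists_norm_networkField_clampedCoupling_le (hγ : IsInterconnection γ)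
    (hlip : ∀ i j, i ≠ j → LocallyLipschitz (γ i j)) (R : ℝ≥0) :
    ∃ C : ℝ≥0, ∀ η, ‖networkField (clampedCoupling γ R) η‖ ≤ C :=
  exists_norm_networkField_le fun i j hij =>
    exists_norm_averagedCoupling_clampCoupling_le R (hlip i j hij) (hγ.map_zero i j hij)

lemma IsInterconnection.clampedCoupling_ne_zero (hγ : IsInterconnection γ)
    (hlip : ∀ i j, i ≠ j → LocallyLipschitz (γ i j)) {R : ℝ≥0} (hR : 0 < R) (i j : Fin m)
    (h : (interconnectionGraph γ).Adj i j) :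
    i ≠ j ∧ ∀ v, v ≠ 0 → clampedCoupling γ R i j v ≠ 0 := by
  obtain ⟨hij, hs⟩ := h
  refine ⟨hij, fun v hv => ?_⟩
  obtain ⟨K, hK⟩ := exists_lipschitzWith_clampCoupling R (hlip i j hij)
  exact averagedCoupling_ne_zero hK.continuous
    (clampCoupling_sector (hγ.map_zero i j hij) (hγ.sector i j hij))
    (fun s => clampCoupling_ne_zero hR fun s => hγ.ne_zero hij hs) hv

lemma isSolutionOn_networkField_of_spread_le {x : ℝ → ArrayState m} {J : Set ℝ} {R : ℝ≥0}
    (hR : ∀ t ∈ J, spread (x t) ≤ R) :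
    IsSolutionOn (averagedHarmonicField γ) x J ↔
      IsSolutionOn (networkField (clampedCoupling γ R)) x J :=
  forall₂_congr fun t ht => by rw [averagedHarmonicField_eq_of_spread_le (hR t ht)]

/-- The freezing level may depend on the solution: its diameter is bounded on a compact interval,
and along it the frozen and original fields coincide. The conclusion does not involve that level, so
afterwards the initial diameter alone suffices as a level. -/
lemma IsInterconnection.spread_antitone (hγ : IsInterconnection γ)
    (hlip : ∀ i j, i ≠ j → LocallyLipschitz (γ i j)) {x : ℝ → ArrayState m} {T s t : ℝ≥0}
    (hx : IsSolutionOn (averagedHarmonicField γ) x (Set.Icc 0 (T : ℝ))) (hst : s ≤ t)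
    (htT : t ≤ T) : spread (x t) ≤ spread (x s) := by
  obtain ⟨R, hR⟩ := isCompact_Icc.bddAbove_image
    ((continuous_spread m).comp_continuousOn (isSolutionOn_continuousOn hx))
  have hR' : ∀ t ∈ Set.Icc (0 : ℝ) T, spread (x t) ≤ R := fun t ht =>
    hR (Set.mem_image_of_mem _ ht)
  obtain ⟨K, hK⟩ := hγ.exists_isRadialCoupling hlip R
  exact spread_solution_antitone hK ((isSolutionOn_networkField_of_spread_le hR').1 hx) hst htT

lemma IsInterconnection.isSolutionOn_clamped (hγ : IsInterconnection γ)
    (hlip : ∀ i j, i ≠ j → LocallyLipschitz (γ i j)) {x : ℝ → ArrayState m} {T R : ℝ≥0}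
    (hx : IsSolutionOn (averagedHarmonicField γ) x (Set.Icc 0 (T : ℝ))) (h0 : spread (x 0) ≤ R) :
    IsSolutionOn (networkField (clampedCoupling γ R)) x (Set.Icc 0 (T : ℝ)) := by
  refine (isSolutionOn_networkField_of_spread_le fun t ht => ?_).1 hx
  lift t to ℝ≥0 using ht.1
  have h := hγ.spread_antitone hlip hx (s := 0) (t := t) zero_le (by exact_mod_cast ht.2)
  rw [NNReal.coe_zero] at h
  exact h.trans h0

lemma IsInterconnection.exists_isSolutionOn (hγ : IsInterconnection γ)
    (hlip : ∀ i j, i ≠ j → LocallyLipschitz (γ i j)) (x₀ : ArrayState m) :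
    ∃ x : ℝ → ArrayState m, x 0 = x₀ ∧ IsSolutionOn (averagedHarmonicField γ) x (Set.Ici 0) := by
  obtain ⟨K, hK⟩ := hγ.exists_isRadialCoupling hlip (spread x₀)
  obtain ⟨C, hC⟩ := hγ.exists_norm_networkField_clampedCoupling_le hlip (spread x₀)
  obtain ⟨L, hL⟩ := exists_lipschitzWith_networkField hK
  obtain ⟨x, hx0, hx⟩ := exists_isSolutionOn_Ici hL hC x₀
  refine ⟨x, hx0, (isSolutionOn_networkField_of_spread_le fun t ht => ?_).2 hx⟩
  lift t to ℝ≥0 using ht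
  have := spread_solution_le hK (hx.mono (J' := Set.Icc 0 (t : ℝ)) Set.Icc_subset_Ici_self)
  rwa [hx0] at this

lemma IsInterconnection.exists_attraction_time (hγ : IsInterconnection γ)
    (hlip : ∀ i j, i ≠ j → LocallyLipschitz (γ i j))
    (hconn : IsConnectedDigraph (interconnectionGraph γ)) (R : ℝ≥0) {ε : ℝ≥0} (hε : 0 < ε) :
    ∃ N : ℝ≥0, ∀ (x : ℝ → ArrayState m) (T t : ℝ≥0),
      IsSolutionOn (averagedHarmonicField γ) x (Set.Icc 0 (T : ℝ)) → spread (x 0) ≤ R →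
        t ≤ T → N ≤ t → spread (x t) ≤ ε := by
  -- Level `R + 1` rather than `R` is positive even for `R = 0`, as needed for the frozen couplings
  -- on edges to stay nonzero off the origin.
  obtain ⟨K, hK⟩ := hγ.exists_isRadialCoupling hlip (R + 1)
  obtain ⟨C, hC⟩ := hγ.exists_norm_networkField_clampedCoupling_le hlip (R + 1)
  obtain ⟨N, hN⟩ := exists_uniform_attraction_time hK hC
    (hγ.clampedCoupling_ne_zero hlip (by positivity)) hconn (R + 1) hε
  refine ⟨N, fun x T t hx h0 => ?_⟩
  have h0' : spread (x 0) ≤ R + 1 := h0.trans le_self_add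
  exact hN x T t (hγ.isSolutionOn_clamped hlip hx h0') h0'

end Interconnection

end

theorem mainTheorem8 (m : ℕ) (γ : Fin m → Fin m → ℝ → ℝ)
    (hγ : IsInterconnection γ)
    (hlip : ∀ i j, i ≠ j → LocallyLipschitz (γ i j))
    (hconn : IsConnectedDigraph (interconnectionGraph γ)) :
    IsGloballyAsymptoticallyStable (averagedHarmonicField γ) (synchronizationManifold m) := by
  obtain ⟨k, -⟩ := id hconn
  have hm : (0 : ℝ≥0) < m := Nat.cast_pos.2 k.pos
  -- The envelope is applied to triples (initial diameter, time, diameter then) over all solutions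
  -- on all bounded intervals, so one `β` covers solutions that are not known to extend.
  have key : ∃ β, IsClassKL β ∧ ∀ s t r, (∃ (x : ℝ → ArrayState m) (T : ℝ≥0),
      IsSolutionOn (averagedHarmonicField γ) x (Set.Icc 0 (T : ℝ)) ∧ t ≤ T ∧
        s = spread (x 0) ∧ r = spread (x t)) → r ≤ β s t := by
    refine exists_isClassKL_of_uniformly_attractive _ ?_ ?_ fun R ε hε => ?_
    · rintro s t r ⟨x, T, hx, ht, rfl, rfl⟩
      simpa using hγ.spread_antitone hlip hx (s := 0) zero_le ht
    · rintro s t t' r' htt ⟨x, T, hx, ht, rfl, rfl⟩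
      exact ⟨_, hγ.spread_antitone hlip hx htt ht, x, T, hx, htt.trans ht, rfl, rfl⟩
    · obtain ⟨N, hN⟩ := hγ.exists_attraction_time hlip hconn R hε
      refine ⟨N, ?_⟩
      rintro s t r ⟨x, T, hx, ht, rfl, rfl⟩ hs hNt
      exact hN x T t hx hs ht hNt
  obtain ⟨β, hβ, hle⟩ := key
  refine ⟨hγ.exists_isSolutionOn hlip, _, hβ.const_mul_comp hm two_pos, fun x T hx t ht => ?_⟩
  calc Metric.infNndist (x t) (synchronizationManifold m) ≤ m * spread (x t) :=
        infNndist_synchronizationManifold_le _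
    _ ≤ m * β (spread (x 0)) t := by gcongr; exact hle _ _ _ ⟨x, T, hx, ht, rfl, rfl⟩
    _ ≤ m * β (2 * Metric.infNndist (x 0) (synchronizationManifold m)) t := by
        gcongr
        exact (hβ.isClassK t).strictMono.monotone (spread_le_two_mul_infNndist _)
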